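/- Let $\mathcal X$ be a measurable space, $P_{\mathrm p},P_{\mathrm n}$ probability measures on $\mathcal X$, $\pi_{\mathrm p}\in(0,1)$ and $\pi_{\mathrm n}=1-\pi_{\mathrm p}$, and let $\mathcal D$ be the distribution on $\mathcal X\times\{+1,-1\}$ with $p(y=+1)=\pi_{\mathrm p}$ and class-conditional distributions $P_{\mathrm p}$ (for $y=+1$) and $P_{\mathrm n}$ (for $y=-1$). Let $\theta\ne\theta'$ in $[0,1]$, $p_{\mathrm{tr}}=\theta P_{\mathrm p}+(1-\theta)P_{\mathrm n}$, $p'_{\mathrm{tr}}=\theta' P_{\mathrm p}+(1-\theta')P_{\mathrm n}$, and $$a=\frac{(1-\theta')\pi_{\mathrm p}}{\theta-\theta'},\quad b=\frac{\theta'(1-\pi_{\mathrm p})}{\theta-\theta'},\quad c=\frac{(1-\theta)\pi_{\mathrm p}}{\theta-\theta'},\quad d=\frac{\theta(1-\pi_{\mathrm p})}{\theta-\theta'}.$$ Let $\mathcal G$ be a class of measurable functions $g:\mathcal X\to\mathbb R$ with $\sup_{g\in\mathcal G}\|g\|_\infty\le C_g$, where $C_g>0$, such that every $g\in\mathcal G$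 is the pointwise limit of a sequence from a fixed countable subset of $\mathcal G$ (so that suprema over $\mathcal G$ are measurable). Let $\ell:\mathbb R\times\{+1,-1\}\to[0,\infty)$ be a loss such that, for each $y\in\{+1,-1\}$, $\ell(t,y)\le C_\ell$ for $|t|\le C_g$, where $C_\ell>0$, and $\ell(\cdot,y)$ is $L_\ell$-Lipschitz on $[-C_g,C_g]$. Put $R(g)=\mathbb E_{(x,y)\sim\mathcal D}[\ell(g(x),y)]$, $R_{\mathrm p}^+(g)=\mathbb E_{x\sim P_{\mathrm p}}[\ell(g(x),+1)]$ and $R_{\mathrm n}^-(g)=\mathbb E_{x\sim P_{\mathrm n}}[\ell(g(x),-1)]$. Let $f_1,f_2:\mathbb R\to\mathbb R$ be $L_f$-Lipschitz and non-negative with $f_1(x)=f_2(x)=x$ for $x\ge0$. For $n,n'\ge1$ and independent i.i.d. samples $x_1,\dots,x_n\sim p_{\mathrm{tr}}$ and $x'_1,\dots,x'_{n'}\sim p'_{\mathrm{tr}}$, put $\widehat R_{\mathrm u}^{\pm}(g)=\frac1n\sum_{i=1}^n\ell(g(x_i),\pm1)$, $\widehat R_{\mathrm u'}^{\pm}(g)=\frac1{n'}\sum_{j=1}^{n'}\ell(g(x'_j),\pm1)$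 and $$\widehat R_{\mathrm{cc}}(g)=f_1\big(a\widehat R_{\mathrm u}^+(g)-c\widehat R_{\mathrm u'}^+(g)\big)+f_2\big(d\widehat R_{\mathrm u'}^-(g)-b\widehat R_{\mathrm u}^-(g)\big).$$ For a probability measure $p$ on $\mathcal X$ and $m\ge1$ let $$\mathfrak R_{m,p}(\mathcal G)=\mathbb E_{x_1,\dots,x_m\sim p}\,\mathbb E_{\varepsilon}\Big[\sup_{g\in\mathcal G}\frac1m\sum_{i=1}^m\varepsilon_i g(x_i)\Big]$$ be the Rademacher complexity, where the $x_i$ are independent and $\varepsilon_1,\dots,\varepsilon_m$ are independent and uniform on $\{+1,-1\}$. Assume that (a) $\inf_{g\in\mathcal G}R_{\mathrm p}^+(g)\ge\alpha/\pi_{\mathrm p}>0$ and $\inf_{g\in\mathcal G}R_{\mathrm n}^-(g)\ge\beta/\pi_{\mathrm n}>0$; (b) $g\in\mathcal G$ if and only if $-g\in\mathcal G$. Let $g^*\in\mathcal G$ minimize $R$ over $\mathcal G$, and let $$\Delta=\exp\Big(-\frac{2\alpha^2/C_\ell^2}{a^2/n+c^2/n'}\Big)+\exp\Big(-\frac{2\beta^2/C_\ell^2}{b^2/n+d^2/n'}\Big),\qquad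 \chi_{n,n'}=\frac{|a|+|b|}{\sqrt n}+\frac{|c|+|d|}{\sqrt{n'}}.$$ Then for every $\delta>0$, with probability at least $1-\delta$ over the two samples, every minimizer $\widehat g_{\mathrm{cc}}$ of $\widehat R_{\mathrm{cc}}$ over $\mathcal G$ satisfies $$R(\widehat g_{\mathrm{cc}})-R(g^*)\le 8(|a|+|b|)L_fL_\ell\,\mathfrak R_{n,p_{\mathrm{tr}}}(\mathcal G)+8(|c|+|d|)L_fL_\ell\,\mathfrak R_{n',p'_{\mathrm{tr}}}(\mathcal G)+2(L_f+1)(|a|+|b|+|c|+|d|)C_\ell\Delta+2C'_\delta\,\chi_{n,n'},$$ where $C'_\delta=C_\ell L_f\sqrt{\ln(1/\delta)/2}$ (read the square root as $0$ if $\delta>1$, when the claim is void). If $\theta>\theta'$, then $a,b,c,d\ge0$ and the absolute values may be dropped. -/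

import Mathlib

open MeasureTheory Filter Topology
open scoped NNReal

noncomputable section

/-! Learning from two unlabeled samples. The label space `{+1, -1}` is `ℤˣ`, a loss is a function
`ℓ : ℝ → ℤˣ → ℝ`, and `P`, `N` are the class-conditional distributions of the positive and of the
negative class on the example space `X`. -/

namespace UU

variable {X : Type*} [MeasurableSpace X]

/-- The joint distribution on `X × {+1, -1}` with class prior `π = p(y = +1)` and
class-conditional distributions `P`, `N`. -/
def joint (π : ℝ) (P N : Measure X) : Measure (X × ℤˣ) :=
  ENNReal.ofReal π • P.map (fun x => (x, (1 : ℤˣ))) +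
    ENNReal.ofReal (1 - π) • N.map (fun x => (x, (-1 : ℤˣ)))

/-- The marginal distribution `θ P + (1 - θ) N` of unlabeled data with class prior `θ`. -/
def mixture (θ : ℝ) (P N : Measure X) : Measure X :=
  ENNReal.ofReal θ • P + ENNReal.ofReal (1 - θ) • N

/-- The classification risk `R(g)`, the expected loss under the joint distribution. -/
def risk (ℓ : ℝ → ℤˣ → ℝ) (π : ℝ) (P N : Measure X) (g : X → ℝ) : ℝ :=
  ∫ z, ℓ (g z.1) z.2 ∂(joint π P N)

/-- The partial risk `E_{x ∼ p} ℓ(g(x), y)` for a fixed label `y`. -/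
def partialRisk (ℓ : ℝ → ℤˣ → ℝ) (y : ℤˣ) (p : Measure X) (g : X → ℝ) : ℝ :=
  ∫ x, ℓ (g x) y ∂p

/-- The empirical partial risk `(1/n) ∑ᵢ ℓ(g(xᵢ), y)`. -/
def empRisk {n : ℕ} (ℓ : ℝ → ℤˣ → ℝ) (y : ℤˣ) (x : Fin n → X) (g : X → ℝ) : ℝ :=
  (1 / (n : ℝ)) * ∑ i, ℓ (g (x i)) y

/-- The coefficient `a` of the risk rewriting. -/
def coefA (π θ θ' : ℝ) : ℝ := (1 - θ') * π / (θ - θ')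

/-- The coefficient `b` of the risk rewriting. -/
def coefB (π θ θ' : ℝ) : ℝ := θ' * (1 - π) / (θ - θ')

/-- The coefficient `c` of the risk rewriting. -/
def coefC (π θ θ' : ℝ) : ℝ := (1 - θ) * π / (θ - θ')

/-- The coefficient `d` of the risk rewriting. -/
def coefD (π θ θ' : ℝ) : ℝ := θ * (1 - π) / (θ - θ')

/-- Consistent correction functions: Lipschitz, non-negative, and the identity on `[0, ∞)`. -/
structure IsConsistentCorrection (f : ℝ → ℝ) : Prop where
  lipschitz : ∃ K : ℝ≥0, LipschitzWith K f
  nonneg : ∀ x, 0 ≤ f x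
  eq_self : ∀ x, 0 ≤ x → f x = x

/-- The consistently corrected risk estimator, evaluated at a pair of unlabeled samples `s`. -/
def correctedRisk {n n' : ℕ} (f₁ f₂ : ℝ → ℝ) (ℓ : ℝ → ℤˣ → ℝ) (π θ θ' : ℝ)
    (s : (Fin n → X) × (Fin n' → X)) (g : X → ℝ) : ℝ :=
  f₁ (coefA π θ θ' * empRisk ℓ 1 s.1 g - coefC π θ θ' * empRisk ℓ 1 s.2 g) +
    f₂ (coefD π θ θ' * empRisk ℓ (-1) s.2 g - coefB π θ θ' * empRisk ℓ (-1) s.1 g)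

/-- The law of two independent i.i.d. samples, of size `n` from the mixture with class prior `θ`
and of size `n'` from the mixture with class prior `θ'`. -/
def sampleLaw (n n' : ℕ) (θ θ' : ℝ) (P N : Measure X) :
    Measure ((Fin n → X) × (Fin n' → X)) :=
  (Measure.pi fun _ : Fin n => mixture θ P N).prod (Measure.pi fun _ : Fin n' => mixture θ' P N)

/-- The Rademacher complexity of the class `G` for samples of size `n` from `p`. The Rademacher
variables are uniform on `{+1, -1}ⁿ`, so their expectation is a finite average. -/
def rademacher (n : ℕ) (p : Measure X) (G : Set (X → ℝ)) : ℝ :=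
  ∫ x : Fin n → X, (1 / (2 : ℝ) ^ n) *
    ∑ ε : Fin n → ℤˣ, ⨆ g : G, (1 / (n : ℝ)) * ∑ i, ((ε i : ℤ) : ℝ) * g.1 (x i)
    ∂(Measure.pi fun _ : Fin n => p)

/-- The usual measurability convention for suprema over a class of functions: every member of `G`
is the pointwise limit of a sequence from a fixed countable subclass. -/
def IsPointwiseSeparable {X : Type*} (G : Set (X → ℝ)) : Prop :=
  ∃ G₀ ⊆ G, G₀.Countable ∧ ∀ g ∈ G, ∃ u : ℕ → X → ℝ,
    (∀ k, u k ∈ G₀) ∧ ∀ x, Tendsto (fun k => u k x) atTop (𝓝 (g x))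

/-- The exponentially small quantity `Δ`; `C` is the bound on the loss. -/
def biasTail (n n' : ℕ) (π θ θ' C α β : ℝ) : ℝ :=
  Real.exp (-((2 * α ^ 2 / C ^ 2) /
      (coefA π θ θ' ^ 2 / (n : ℝ) + coefC π θ θ' ^ 2 / (n' : ℝ)))) +
    Real.exp (-((2 * β ^ 2 / C ^ 2) /
      (coefB π θ θ' ^ 2 / (n : ℝ) + coefD π θ θ' ^ 2 / (n' : ℝ))))

end UU

end

/-! Write `A(g)` and `B(g)` for the arguments of `f₁` and `f₂` in the corrected risk. The
coefficients are chosen so that their means are `π R_p⁺(g)` and `(1 - π) R_n⁻(g)`, whose sum is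
the risk `R(g)`. Both means are non-negative, hence fixed by the corrections, so that

`|R̂(g) - R(g)| ≤ L_f (|A(g) - E A(g)| + |B(g) - E B(g)|)`

(`abs_correctedRisk_sub_risk_le`). Comparing with the non-random risk rather than with the mean of
the corrected risk thus leaves no bias to estimate, and the term with `Δ ≥ 0` in the bound is not
needed. For a minimizer `ĝ` the excess risk is at most twice the supremum over the class of the
right-hand side, which is at most `L_f` times `U(x) + V(x')`, where `U` and `V` are weighted sums
of the uniform deviations of the empirical partial risks of the two samples.

The variables `U(x)` and `V(x')` are independent functions with bounded differences, so
McDiarmid's inequality (`hasSubgaussianMGF_of_bounded_differences`, obtained from Hoeffding's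
lemma by tensorization) makes their deviations from the mean sub-Gaussian; this is the `χ` term.
The mean uniform deviation is at most `4 L_ℓ` times the Rademacher complexity
(`integral_unifDev_le`): a factor `2` comes from symmetrization
(`integral_ciSup_abs_average_sub_le`) and a factor `2 L_ℓ` from the contraction principle
(`sum_signs_ciSup_le`), applied to the class with the zero function adjoined in order to handle
absolute values (`sum_signs_ciSup_abs_comp_le`); this is where the symmetry `G = -G` enters.
Suprema over the class are replaced by suprema over the countable subclass wherever measurability
is needed. -/

namespace UU

/-! ### The contraction principle -/

/-- The case of a single sign in the contraction principle: the sum of the suprema over both signs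
does not increase when the signed part `w` is replaced by `v` with smaller increments. -/
lemma ciSup_add_add_ciSup_sub_le {ι : Type*} [Nonempty ι] {u v w : ι → ℝ}
    (h : ∀ i j, |v i - v j| ≤ |w i - w j|)
    (hadd : BddAbove (Set.range fun i => u i + w i))
    (hsub : BddAbove (Set.range fun i => u i - w i)) :
    (⨆ i, (u i + v i)) + ⨆ i, (u i - v i) ≤ (⨆ i, (u i + w i)) + ⨆ i, (u i - w i) := by
  rw [← le_sub_iff_add_le]
  refine ciSup_le fun i => ?_
  rw [le_sub_comm]
  refine ciSup_le fun j => ?_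
  have h₁ := h i j
  have h₂ := le_abs_self (v i - v j)
  have hi₁ := le_ciSup hadd i
  have hi₂ := le_ciSup hsub i
  have hj₁ := le_ciSup hadd j
  have hj₂ := le_ciSup hsub j
  rcases abs_cases (w i - w j) with ⟨h₃, -⟩ | ⟨h₃, -⟩ <;> linarith

lemma abs_intUnit (ε : ℤˣ) : |((ε : ℤ) : ℝ)| = 1 := by
  rcases Int.units_eq_one_or ε with rfl | rfl <;> simp

lemma abs_sum_signs_le {n : ℕ} (ε : Fin n → ℤˣ) {t M : Fin n → ℝ} (h : ∀ k, |t k| ≤ M k) :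
    |∑ k, ((ε k : ℤ) : ℝ) * t k| ≤ ∑ k, M k := by
  refine (Finset.abs_sum_le_sum_abs _ _).trans (Finset.sum_le_sum fun k _ => ?_)
  rw [abs_mul, abs_intUnit, one_mul]
  exact h k

lemma bddAbove_range_of_abs_le {ι : Type*} {u : ι → ℝ} {M : ℝ} (h : ∀ i, |u i| ≤ M) :
    BddAbove (Set.range u) :=
  ⟨M, by rintro _ ⟨i, rfl⟩; exact (le_abs_self _).trans (h i)⟩

lemma sum_signs_succ {n : ℕ} (F : (Fin (n + 1) → ℤˣ) → ℝ) :
    ∑ ε, F ε = ∑ ε : Fin n → ℤˣ, (F (Fin.cons 1 ε) + F (Fin.cons (-1) ε)) := by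
  rw [← (Fin.consEquiv fun _ => ℤˣ).sum_comp, Fintype.sum_prod_type, Finset.sum_comm]
  refine Finset.sum_congr rfl fun ε _ => ?_
  rw [show (Finset.univ : Finset ℤˣ) = {1, -1} from rfl, Finset.sum_pair (by decide)]
  rfl

/-- The contraction principle for Rademacher averages: replacing the coordinates `w k` by
coordinates `v k` with smaller increments does not increase the sum over signs of the supremum.
The offset `u` is what makes the induction on the number of coordinates work. -/
lemma sum_signs_ciSup_le {ι : Type*} [Nonempty ι] {n : ℕ} (u : ι → ℝ) (v w : Fin n → ι → ℝ)
    (h : ∀ k i j, |v k i - v k j| ≤ |w k i - w k j|) {U : ℝ} {V W : Fin n → ℝ}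
    (hu : ∀ i, |u i| ≤ U) (hv : ∀ k i, |v k i| ≤ V k) (hw : ∀ k i, |w k i| ≤ W k) :
    ∑ ε : Fin n → ℤˣ, ⨆ i, (u i + ∑ k, ((ε k : ℤ) : ℝ) * v k i) ≤
      ∑ ε : Fin n → ℤˣ, ⨆ i, (u i + ∑ k, ((ε k : ℤ) : ℝ) * w k i) := by
  induction n generalizing u U with
  | zero => simp
  | succ n ih =>
    -- Contract coordinate `0` with the other signs fixed, then absorb it into the offset.
    simp only [sum_signs_succ, Fin.sum_univ_succ, Fin.cons_zero, Fin.cons_succ, Units.val_one,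
      Int.cast_one, one_mul, Units.val_neg, Int.cast_neg, neg_one_mul]
    calc _ ≤ ∑ ε : Fin n → ℤˣ,
          ((⨆ i, (u i + w 0 i + ∑ k, ((ε k : ℤ) : ℝ) * v k.succ i)) +
            ⨆ i, (u i - w 0 i + ∑ k, ((ε k : ℤ) : ℝ) * v k.succ i)) := by
          refine Finset.sum_le_sum fun ε _ => ?_
          have key : ∀ i, |∑ k, ((ε k : ℤ) : ℝ) * v k.succ i| ≤ ∑ k : Fin n, V k.succ :=
            fun i => abs_sum_signs_le ε fun k => hv k.succ i
          have := ciSup_add_add_ciSup_sub_le (v := v 0) (w := w 0)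
            (u := fun i => u i + ∑ k, ((ε k : ℤ) : ℝ) * v k.succ i) (h 0)
            (bddAbove_range_of_abs_le (M := U + (∑ k : Fin n, V k.succ) + W 0) fun i =>
              (abs_add_le _ _).trans (add_le_add ((abs_add_le _ _).trans
                (add_le_add (hu i) (key i))) (hw 0 i)))
            (bddAbove_range_of_abs_le (M := U + (∑ k : Fin n, V k.succ) + W 0) fun i =>
              (abs_sub _ _).trans (add_le_add ((abs_add_le _ _).trans
                (add_le_add (hu i) (key i))) (hw 0 i)))
          refine le_of_eq_of_le ?_ (this.trans_eq ?_) <;> congr 1 <;>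
            exact iSup_congr fun i => by ring
      _ ≤ _ := by
          rw [Finset.sum_add_distrib, Finset.sum_add_distrib]
          refine add_le_add ?_ ?_
          · refine (ih (fun i => u i + w 0 i) (fun k => v k.succ) (fun k => w k.succ)
              (fun k => h k.succ) (U := U + W 0)
              (fun i => (abs_add_le _ _).trans (add_le_add (hu i) (hw 0 i)))
              (fun k => hv k.succ) (fun k => hw k.succ)).trans_eq ?_
            simp only [add_assoc]
          · refine (ih (fun i => u i - w 0 i) (fun k => v k.succ) (fun k => w k.succ)
              (fun k => h k.succ) (U := U + W 0)
              (fun i => (abs_sub _ _).trans (add_le_add (hu i) (hw 0 i)))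
              (fun k => hv k.succ) (fun k => hw k.succ)).trans_eq ?_
            simp only [sub_eq_add_neg, add_assoc]

lemma abs_ciSup_le_of_abs_le {ι : Type*} [Nonempty ι] {u : ι → ℝ} {M : ℝ} (h : ∀ i, |u i| ≤ M) :
    |⨆ i, u i| ≤ M := by
  obtain ⟨i₀⟩ := ‹Nonempty ι›
  have : Nonempty ι := ⟨i₀⟩
  refine abs_le.2 ⟨?_, ciSup_le fun i => (le_abs_self _).trans (h i)⟩
  exact (abs_le.1 (h i₀)).1.trans (le_ciSup (bddAbove_range_of_abs_le h) i₀)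

lemma abs_ciSup_sub_ciSup_le {ι : Type*} [Nonempty ι] {u v : ι → ℝ} {c : ℝ}
    (hu : BddAbove (Set.range u)) (hv : BddAbove (Set.range v)) (h : ∀ i, |u i - v i| ≤ c) :
    |(⨆ i, u i) - ⨆ i, v i| ≤ c := by
  rw [abs_sub_le_iff, sub_le_iff_le_add, sub_le_iff_le_add]
  constructor
  · refine ciSup_le fun i => ?_
    linarith [le_ciSup hv i, (abs_sub_le_iff.1 (h i)).1]
  · refine ciSup_le fun i => ?_
    linarith [le_ciSup hu i, (abs_sub_le_iff.1 (h i)).2]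

lemma abs_signed_average_le {n : ℕ} (hn : 1 ≤ n) (ε : Fin n → ℤˣ) {t : Fin n → ℝ} {M : ℝ}
    (h : ∀ k, |t k| ≤ M) : |(1 / (n : ℝ)) * ∑ k, ((ε k : ℤ) : ℝ) * t k| ≤ M := by
  have hn' : (0 : ℝ) < n := by exact_mod_cast hn
  rw [abs_mul, abs_of_pos (by positivity)]
  have := abs_sum_signs_le ε (M := fun _ => M) h
  rw [Finset.sum_const, Finset.card_univ, Fintype.card_fin, nsmul_eq_mul] at this
  rw [one_div, inv_mul_le_iff₀ hn']
  exact this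

/-- Contraction for absolute values: for a symmetric family of vectors `t i`, composing the
coordinates with a Lipschitz function costs a factor `2 L`. Adjoining the zero vector, as `none`,
makes all suprema non-negative, so that the absolute value is at most a sum of two of them. -/
lemma sum_signs_ciSup_abs_comp_le {ι : Type*} [Nonempty ι] {n : ℕ} {t : ι → Fin n → ℝ} {C : ℝ}
    (ht : ∀ i k, |t i k| ≤ C) (hneg : ∀ i, ∃ j, t j = -t i) {L : ℝ≥0} {ψ : ℝ → ℝ}
    (hψ : LipschitzWith L ψ) :
    ∑ ε : Fin n → ℤˣ, ⨆ i, |(1 / (n : ℝ)) * ∑ k, ((ε k : ℤ) : ℝ) * (ψ (t i k) - ψ 0)| ≤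
      2 * L * ∑ ε : Fin n → ℤˣ, ⨆ i, (1 / (n : ℝ)) * ∑ k, ((ε k : ℤ) : ℝ) * t i k := by
  have hψ' : ∀ r s, |ψ r - ψ s| ≤ L * |r - s| := fun r s => by
    simpa [Real.dist_eq] using hψ.dist_le_mul r s
  have hn : (0 : ℝ) ≤ 1 / n := by positivity
  -- `v` and `w` carry the factor `1 / n`, which lets the average be treated as a plain sum.
  set v : Fin n → Option ι → ℝ := fun k o => o.elim 0 fun i => 1 / (n : ℝ) * (ψ (t i k) - ψ 0)
    with hv
  set w : Fin n → Option ι → ℝ := fun k o => o.elim 0 fun i => 1 / (n : ℝ) * (L * t i k) with hw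
  have hvw : ∀ k o o', |v k o - v k o'| ≤ |w k o - w k o'| := by
    have key : ∀ r s, |1 / (n : ℝ) * (ψ r - ψ 0) - 1 / (n : ℝ) * (ψ s - ψ 0)| ≤
        |1 / (n : ℝ) * (L * r) - 1 / (n : ℝ) * (L * s)| := fun r s => by
      rw [← mul_sub, ← mul_sub, ← mul_sub, abs_mul, abs_mul, abs_mul, NNReal.abs_eq,
        sub_sub_sub_cancel_right]
      exact mul_le_mul_of_nonneg_left (hψ' r s) (abs_nonneg _)
    rintro k (_ | i) (_ | j)
    · simp [hv, hw]
    · simpa [hv, hw] using key 0 (t j k)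
    · simpa [hv, hw] using key (t i k) 0
    · exact key (t i k) (t j k)
  have hwb : ∀ k o, |w k o| ≤ 1 / (n : ℝ) * (L * |C|) := by
    rintro k (_ | i)
    · simp only [hw, Option.elim_none, abs_zero]
      positivity
    · simp only [hw, Option.elim_some]
      rw [abs_mul, abs_mul, NNReal.abs_eq, abs_of_nonneg hn]
      exact mul_le_mul_of_nonneg_left (mul_le_mul_of_nonneg_left ((ht i k).trans (le_abs_self C))
        L.coe_nonneg) hn
  have hvb : ∀ k o, |v k o| ≤ 1 / (n : ℝ) * (L * |C|) := fun k o => by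
    have := hvw k o none
    simp only [hv, hw, Option.elim_none, sub_zero] at this
    exact this.trans (hwb k o)
  have hcontr := sum_signs_ciSup_le (fun _ : Option ι => (0 : ℝ)) v w hvw (U := 0) (by simp)
    hvb hwb
  simp only [zero_add] at hcontr
  have hvbdd : ∀ ε : Fin n → ℤˣ, BddAbove (Set.range fun o => ∑ k, ((ε k : ℤ) : ℝ) * v k o) :=
    fun ε => bddAbove_range_of_abs_le fun o => abs_sum_signs_le ε fun k => hvb k o
  have hvnn : ∀ ε : Fin n → ℤˣ, 0 ≤ ⨆ o, ∑ k, ((ε k : ℤ) : ℝ) * v k o := fun ε => by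
    simpa [hv] using le_ciSup (hvbdd ε) none
  have hsome : ∀ (ε : Fin n → ℤˣ) i, (1 / (n : ℝ)) * ∑ k, ((ε k : ℤ) : ℝ) * (ψ (t i k) - ψ 0) =
      ∑ k, ((ε k : ℤ) : ℝ) * v k (some i) := fun ε i => by
    rw [Finset.mul_sum]
    exact Finset.sum_congr rfl fun k _ => mul_left_comm _ _ _
  have habs : ∀ ε : Fin n → ℤˣ,
      ⨆ i, |(1 / (n : ℝ)) * ∑ k, ((ε k : ℤ) : ℝ) * (ψ (t i k) - ψ 0)| ≤
        (⨆ o, ∑ k, ((ε k : ℤ) : ℝ) * v k o) + ⨆ o, ∑ k, (((-ε) k : ℤ) : ℝ) * v k o := by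
    intro ε
    refine ciSup_le fun i => ?_
    rw [hsome]
    have h₁ := le_ciSup (hvbdd ε) (some i)
    have h₂ := le_ciSup (hvbdd (-ε)) (some i)
    simp only [Pi.neg_apply, Units.val_neg, Int.cast_neg, neg_mul, Finset.sum_neg_distrib] at h₂
    have h₃ := hvnn ε
    have h₄ := hvnn (-ε)
    simp only [Pi.neg_apply, Units.val_neg, Int.cast_neg, neg_mul, Finset.sum_neg_distrib] at h₄ ⊢
    exact abs_le.2 ⟨by linarith, by linarith⟩
  have hsup : ∀ ε : Fin n → ℤˣ, ⨆ o, ∑ k, ((ε k : ℤ) : ℝ) * w k o ≤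
      L * ⨆ i, (1 / (n : ℝ)) * ∑ k, ((ε k : ℤ) : ℝ) * t i k := by
    intro ε
    have hb : BddAbove (Set.range fun i => (1 / (n : ℝ)) * ∑ k, ((ε k : ℤ) : ℝ) * t i k) := by
      refine bddAbove_range_of_abs_le (M := 1 / (n : ℝ) * ∑ _k : Fin n, C) fun i => ?_
      rw [abs_mul, abs_of_nonneg hn]
      exact mul_le_mul_of_nonneg_left (abs_sum_signs_le ε fun k => ht i k) hn
    refine ciSup_le fun o => ?_
    cases o with
    | none =>
      -- The sum is `0`, and a supremum over a symmetric family is non-negative.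
      obtain ⟨i⟩ := ‹Nonempty ι›
      obtain ⟨j, hj⟩ := hneg i
      have hi' := le_ciSup hb i
      have hj' := le_ciSup hb j
      simp only [hj, Pi.neg_apply, mul_neg, Finset.sum_neg_distrib] at hj'
      simp only [hw, Option.elim_none, mul_zero, Finset.sum_const_zero]
      exact mul_nonneg L.coe_nonneg (by linarith)
    | some i =>
      refine le_of_eq_of_le ?_ (mul_le_mul_of_nonneg_left (le_ciSup hb i) L.coe_nonneg)
      simp only [hw, Option.elim_some, Finset.mul_sum]
      exact Finset.sum_congr rfl fun k _ => by ring
  calc _ ≤ ∑ ε : Fin n → ℤˣ, ((⨆ o, ∑ k, ((ε k : ℤ) : ℝ) * v k o) +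
        ⨆ o, ∑ k, (((-ε) k : ℤ) : ℝ) * v k o) := Finset.sum_le_sum fun ε _ => habs ε
    _ = 2 * ∑ ε : Fin n → ℤˣ, ⨆ o, ∑ k, ((ε k : ℤ) : ℝ) * v k o := by
        rw [Finset.sum_add_distrib, two_mul]
        congr 1
        exact Equiv.sum_comp (Equiv.neg (Fin n → ℤˣ)) fun ε => ⨆ o, ∑ k, ((ε k : ℤ) : ℝ) * v k o
    _ ≤ 2 * ∑ ε : Fin n → ℤˣ, ⨆ o, ∑ k, ((ε k : ℤ) : ℝ) * w k o := by gcongr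
    _ ≤ 2 * ∑ ε : Fin n → ℤˣ, L * ⨆ i, (1 / (n : ℝ)) * ∑ k, ((ε k : ℤ) : ℝ) * t i k := by
        gcongr with ε
        exact hsup ε
    _ = _ := by rw [← Finset.mul_sum, mul_assoc]

/-! ### McDiarmid's inequality -/

lemma integrable_of_abs_le {Ω : Type*} [MeasurableSpace Ω] {μ : Measure Ω} [IsFiniteMeasure μ]
    {f : Ω → ℝ} {M : ℝ} (hf : Measurable f) (hM : ∀ x, |f x| ≤ M) : Integrable f μ :=
  Integrable.of_bound hf.aestronglyMeasurable M (.of_forall hM)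

lemma abs_integral_le_of_abs_le {Ω : Type*} [MeasurableSpace Ω] {μ : Measure Ω}
    [IsProbabilityMeasure μ] {f : Ω → ℝ} {M : ℝ} (hM : ∀ x, |f x| ≤ M) : |∫ x, f x ∂μ| ≤ M := by
  have := norm_integral_le_of_norm_le_const (μ := μ) (f := f) (.of_forall hM)
  simpa using this

open ProbabilityTheory in
/-- Hoeffding's lemma for a function of oscillation at most `c`. -/
lemma hasSubgaussianMGF_of_abs_sub_le {Ω : Type*} [MeasurableSpace Ω] {μ : Measure Ω}
    [IsProbabilityMeasure μ] {f : Ω → ℝ} (hf : Measurable f) {c : ℝ≥0}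
    (hc : ∀ x y, |f x - f y| ≤ c) :
    HasSubgaussianMGF (fun x => f x - ∫ y, f y ∂μ) ((c / 2) ^ 2) μ := by
  have : Nonempty Ω := nonempty_of_isProbabilityMeasure μ
  have hbdd : BddBelow (Set.range f) := by
    obtain ⟨x₀⟩ := this
    refine ⟨f x₀ - c, ?_⟩
    rintro _ ⟨y, rfl⟩
    linarith [le_abs_self (f x₀ - f y), hc x₀ y]
  have h := hasSubgaussianMGF_of_mem_Icc (μ := μ) (X := f) (a := ⨅ y, f y) (b := (⨅ y, f y) + c)
    hf.aemeasurable (.of_forall fun x => ⟨ciInf_le hbdd x, by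
      rw [← sub_le_iff_le_add]
      exact le_ciInf fun y => by linarith [le_abs_self (f x - f y), hc x y]⟩)
  simpa using h

open ProbabilityTheory in
/-- Tensorization of sub-Gaussian deviations: a deviation `f - E f` on a product splits into the
deviation of `f(·, y)` for fixed `y` and that of the partial mean `y ↦ ∫ f(x, y)`. -/
lemma hasSubgaussianMGF_prod {Ω Ω' : Type*} [MeasurableSpace Ω] [MeasurableSpace Ω']
    {μ : Measure Ω} {ν : Measure Ω'} [IsProbabilityMeasure μ] [IsProbabilityMeasure ν]
    {f : Ω × Ω' → ℝ} (hf : Measurable f) {M : ℝ} (hM : ∀ z, |f z| ≤ M) {c₁ c₂ : ℝ≥0}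
    (h₁ : ∀ y, HasSubgaussianMGF (fun x => f (x, y) - ∫ x', f (x', y) ∂μ) c₁ μ)
    (h₂ : HasSubgaussianMGF (fun y => ∫ x, f (x, y) ∂μ - ∫ y', ∫ x, f (x, y') ∂μ ∂ν) c₂ ν) :
    HasSubgaussianMGF (fun z => f z - ∫ z', f z' ∂(μ.prod ν)) (c₁ + c₂) (μ.prod ν) := by
  have hint : Integrable f (μ.prod ν) := integrable_of_abs_le hf hM
  have hI : ∫ z', f z' ∂(μ.prod ν) = ∫ y', ∫ x, f (x, y') ∂μ ∂ν := integral_prod_symm f hint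
  have hexp : ∀ t : ℝ,
      Integrable (fun z => Real.exp (t * (f z - ∫ z', f z' ∂(μ.prod ν)))) (μ.prod ν) := by
    intro t
    refine integrable_of_abs_le (M := Real.exp (|t| * (M + |∫ z', f z' ∂(μ.prod ν)|)))
      (by fun_prop) fun z => ?_
    rw [Real.abs_exp, Real.exp_le_exp]
    refine (le_abs_self _).trans ?_
    rw [abs_mul]
    gcongr
    exact (abs_sub _ _).trans (by gcongr; exact hM z)
  refine ⟨hexp, fun t => ?_⟩
  rw [mgf, integral_prod_symm _ (hexp t)]
  -- The deviation of the partial mean does not depend on `x` and leaves the inner integral.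
  have hsplit : ∀ y, ∫ x, Real.exp (t * (f (x, y) - ∫ z', f z' ∂(μ.prod ν))) ∂μ =
      Real.exp (t * (∫ x, f (x, y) ∂μ - ∫ y', ∫ x, f (x, y') ∂μ ∂ν)) *
        ∫ x, Real.exp (t * (f (x, y) - ∫ x', f (x', y) ∂μ)) ∂μ := by
    intro y
    rw [← integral_const_mul]
    refine integral_congr_ae (.of_forall fun x => ?_)
    dsimp only
    rw [← Real.exp_add, hI]
    ring_nf
  simp_rw [hsplit]
  calc _ ≤ ∫ y, Real.exp (t * (∫ x, f (x, y) ∂μ - ∫ y', ∫ x, f (x, y') ∂μ ∂ν)) *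
        Real.exp (c₁ * t ^ 2 / 2) ∂ν := by
        refine integral_mono_of_nonneg (.of_forall fun y => ?_)
          ((h₂.integrable_exp_mul t).mul_const _) (.of_forall fun y => ?_)
        · exact mul_nonneg (Real.exp_nonneg _) (integral_nonneg fun x => Real.exp_nonneg _)
        · exact mul_le_mul_of_nonneg_left ((h₁ y).mgf_le t) (Real.exp_nonneg _)
    _ ≤ Real.exp (c₂ * t ^ 2 / 2) * Real.exp (c₁ * t ^ 2 / 2) := by
        rw [integral_mul_const]
        exact mul_le_mul_of_nonneg_right (h₂.mgf_le t) (Real.exp_nonneg _)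
    _ = _ := by
        rw [← Real.exp_add]
        push_cast
        ring_nf

open ProbabilityTheory in
/-- McDiarmid's bounded differences inequality, as a bound on the moment generating function. -/
lemma hasSubgaussianMGF_of_bounded_differences {X : Type*} [MeasurableSpace X] {n : ℕ}
    {μ : Measure X} [IsProbabilityMeasure μ] {f : (Fin n → X) → ℝ} (hf : Measurable f) {M : ℝ}
    (hM : ∀ x, |f x| ≤ M) {c : Fin n → ℝ≥0}
    (hc : ∀ i x z, |f x - f (Function.update x i z)| ≤ c i) :
    HasSubgaussianMGF (fun x => f x - ∫ x', f x' ∂(Measure.pi fun _ : Fin n => μ))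
      (∑ i, (c i / 2) ^ 2) (Measure.pi fun _ : Fin n => μ) := by
  induction n generalizing M with
  | zero =>
    have : ∀ x, f x - ∫ x', f x' ∂(Measure.pi fun _ : Fin 0 => μ) = 0 := fun x => by
      have : ∀ x', f x' = f x := fun x' => by rw [Subsingleton.elim x' x]
      simp [this]
    simp only [this, Finset.univ_eq_empty, Finset.sum_empty]
    exact HasSubgaussianMGF.fun_zero
  | succ n ih =>
    -- Split off coordinate `0`; averaging over it preserves the other bounded differences.
    have hcons : Measurable fun z : X × (Fin n → X) => (Fin.cons z.1 z.2 : Fin (n + 1) → X) :=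
      measurable_pi_lambda _ fun i => by
        refine Fin.cases ?_ (fun j => ?_) i
        · simpa using measurable_fst
        · simpa [Function.comp_def] using (measurable_pi_apply j).comp measurable_snd
    have hmp : MeasurePreserving (MeasurableEquiv.piFinSuccAbove (fun _ => X) 0)
        (Measure.pi fun _ : Fin (n + 1) => μ) (μ.prod (Measure.pi fun _ : Fin n => μ)) :=
      measurePreserving_piFinSuccAbove (fun _ => μ) 0
    have hF : Measurable fun z : X × (Fin n → X) => f (Fin.cons z.1 z.2) := hf.comp hcons
    have hprod := hasSubgaussianMGF_prod (μ := μ) (ν := Measure.pi fun _ : Fin n => μ) hF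
      (M := M) (fun z => hM _) (c₁ := (c 0 / 2) ^ 2) (c₂ := ∑ i : Fin n, (c i.succ / 2) ^ 2)
      (fun y => hasSubgaussianMGF_of_abs_sub_le (f := fun x => f (Fin.cons x y))
        (hF.comp measurable_prodMk_right) fun x x' => by
          simpa using hc 0 (Fin.cons x y) x')
      (ih (f := fun y => ∫ x, f (Fin.cons x y) ∂μ) (M := M) ?_
        (fun y => abs_integral_le_of_abs_le fun x => hM _) fun i y z => ?_)
    · have hcomp := HasSubgaussianMGF.of_map (X := fun z : X × (Fin n → X) =>
        f (Fin.cons z.1 z.2) - ∫ z', f (Fin.cons z'.1 z'.2) ∂(μ.prod (Measure.pi fun _ => μ)))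
        (Y := MeasurableEquiv.piFinSuccAbove (fun _ => X) 0)
        (μ := Measure.pi fun _ : Fin (n + 1) => μ) hmp.measurable.aemeasurable
        (by rw [hmp.map_eq]; exact hprod)
      have hid : ∀ x : Fin (n + 1) → X,
          (Fin.cons (MeasurableEquiv.piFinSuccAbove (fun _ => X) 0 x).1
          (MeasurableEquiv.piFinSuccAbove (fun _ => X) 0 x).2 : Fin (n + 1) → X) = x :=
        fun x => Fin.cons_self_tail x
      rw [Fin.sum_univ_succ]
      convert hcomp using 1
      funext x
      rw [Function.comp_apply, hid, ← hmp.integral_comp' (g := fun z' => f (Fin.cons z'.1 z'.2))]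
      simp_rw [hid]
    · exact (hF.stronglyMeasurable.integral_prod_left' (μ := μ)).measurable
    · have hi : ∀ y, Integrable (fun x => f (Fin.cons x y)) μ := fun y =>
        integrable_of_abs_le (hF.comp measurable_prodMk_right) fun x => hM _
      rw [← integral_sub (hi _) (hi _)]
      refine abs_integral_le_of_abs_le fun x => ?_
      rw [Fin.cons_update]
      exact hc i.succ _ z

/-! ### Symmetrization -/

/-- Exchanging the `k`-th points of two i.i.d. samples for every `k` with `ε k = -1`. -/
def swapSigned {X : Type*} {n : ℕ} (ε : Fin n → ℤˣ) (z : Fin n → X × X) : Fin n → X × X :=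
  fun k => if ε k = 1 then z k else (z k).swap

lemma measurePreserving_swapSigned {X : Type*} [MeasurableSpace X] {n : ℕ} (μ : Measure X)
    [IsProbabilityMeasure μ] (ε : Fin n → ℤˣ) :
    MeasurePreserving (swapSigned ε) (Measure.pi fun _ : Fin n => μ.prod μ)
      (Measure.pi fun _ : Fin n => μ.prod μ) := by
  refine measurePreserving_pi (f := fun k (p : X × X) => if ε k = 1 then p else p.swap) _ _
    fun k => ?_
  by_cases h : ε k = 1
  · simp only [h, if_true]
    exact MeasurePreserving.id (μ.prod μ)
  · simpa [h] using Measure.measurePreserving_swap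

/-- The sup over a class of signed averages of differences of two samples has the same mean for
every choice of signs. -/
lemma integral_signed_difference_eq {X ι : Type*} [MeasurableSpace X] [Countable ι] {n : ℕ}
    (μ : Measure X) [IsProbabilityMeasure μ] {F : ι → X → ℝ} (hF : ∀ i, Measurable (F i))
    (ε : Fin n → ℤˣ) :
    ∫ z : (Fin n → X) × (Fin n → X), (⨆ i, |(1 / (n : ℝ)) *
        ∑ k, ((ε k : ℤ) : ℝ) * (F i (z.1 k) - F i (z.2 k))|)
      ∂((Measure.pi fun _ => μ).prod (Measure.pi fun _ => μ)) =
    ∫ z : (Fin n → X) × (Fin n → X), (⨆ i, |(1 / (n : ℝ)) * ∑ k, (F i (z.1 k) - F i (z.2 k))|)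
      ∂((Measure.pi fun _ => μ).prod (Measure.pi fun _ => μ)) := by
  have he := measurePreserving_arrowProdEquivProdArrow X X (Fin n) (fun _ => μ) (fun _ => μ)
  rw [← he.integral_comp', ← he.integral_comp']
  have hσ := measurePreserving_swapSigned (n := n) μ ε
  conv_rhs => rw [← hσ.map_eq]
  rw [integral_map hσ.measurable.aemeasurable]
  · refine integral_congr_ae (.of_forall fun z => ?_)
    refine iSup_congr fun i => ?_
    congr 2
    refine Finset.sum_congr rfl fun k _ => ?_
    rcases Int.units_eq_one_or (ε k) with h | h <;>
      simp [MeasurableEquiv.arrowProdEquivProdArrow, Equiv.arrowProdEquivProdArrow, swapSigned, h]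
  · refine (Measurable.comp (g := fun z : (Fin n → X) × (Fin n → X) => ⨆ i, |(1 / (n : ℝ)) *
      ∑ k, (F i (z.1 k) - F i (z.2 k))|) ?_ (MeasurableEquiv.measurable _)).aestronglyMeasurable
    refine Measurable.iSup fun i => ?_
    have := hF i
    fun_prop

/-- Symmetrization: the mean uniform deviation of empirical averages is at most twice the mean
absolute Rademacher average. -/
lemma integral_ciSup_abs_average_sub_le {X ι : Type*} [MeasurableSpace X] [Countable ι]
    [Nonempty ι] {n : ℕ} (hn : 1 ≤ n) (μ : Measure X) [IsProbabilityMeasure μ] {F : ι → X → ℝ}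
    (hF : ∀ i, Measurable (F i)) {M : ℝ} (hM : ∀ i x, |F i x| ≤ M) :
    ∫ x : Fin n → X, (⨆ i, |(1 / (n : ℝ)) * ∑ k, F i (x k) - ∫ y, F i y ∂μ|)
        ∂(Measure.pi fun _ => μ) ≤
      2 * ∫ x : Fin n → X, (1 / (2 : ℝ) ^ n) *
        ∑ ε : Fin n → ℤˣ, ⨆ i, |(1 / (n : ℝ)) * ∑ k, ((ε k : ℤ) : ℝ) * F i (x k)|
        ∂(Measure.pi fun _ => μ) := by
  have hn₀ : (n : ℝ) ≠ 0 := by exact_mod_cast (Nat.one_le_iff_ne_zero.1 hn)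
  set μn : Measure (Fin n → X) := Measure.pi fun _ => μ with hμn
  set H : (Fin n → ℤˣ) → (Fin n → X) × (Fin n → X) → ℝ := fun ε z => ⨆ i, |(1 / (n : ℝ)) *
    ∑ k, ((ε k : ℤ) : ℝ) * (F i (z.1 k) - F i (z.2 k))| with hH
  set S : (Fin n → ℤˣ) → (Fin n → X) → ℝ := fun ε x => ⨆ i, |(1 / (n : ℝ)) *
    ∑ k, ((ε k : ℤ) : ℝ) * F i (x k)| with hS
  have hFd : ∀ i x y, |F i x - F i y| ≤ M + M := fun i x y =>
    (abs_sub _ _).trans (add_le_add (hM i x) (hM i y))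
  have hHmeas : ∀ ε, Measurable (H ε) := fun ε => Measurable.iSup fun i => by
    have := hF i
    fun_prop
  have hSmeas : ∀ ε, Measurable (S ε) := fun ε => Measurable.iSup fun i => by
    have := hF i
    fun_prop
  have hHterm : ∀ (ε : Fin n → ℤˣ) (z : (Fin n → X) × (Fin n → X)) i, |(1 / (n : ℝ)) *
      ∑ k, ((ε k : ℤ) : ℝ) * (F i (z.1 k) - F i (z.2 k))| ≤ M + M :=
    fun ε z i => abs_signed_average_le hn ε fun k => hFd i _ _
  have hSterm : ∀ (ε : Fin n → ℤˣ) (x : Fin n → X) i,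
      |(1 / (n : ℝ)) * ∑ k, ((ε k : ℤ) : ℝ) * F i (x k)| ≤ M :=
    fun ε x i => abs_signed_average_le hn ε fun k => hM i _
  have hHint : ∀ ε, Integrable (H ε) (μn.prod μn) := fun ε =>
    integrable_of_abs_le (hHmeas ε) fun z =>
      abs_ciSup_le_of_abs_le fun i => (abs_abs _).trans_le (hHterm ε z i)
  have hSint : ∀ ε, Integrable (S ε) μn := fun ε =>
    integrable_of_abs_le (hSmeas ε) fun x =>
      abs_ciSup_le_of_abs_le fun i => (abs_abs _).trans_le (hSterm ε x i)
  have hmean : ∀ i, ∫ x' : Fin n → X, (1 / (n : ℝ)) * ∑ k, F i (x' k) ∂μn = ∫ y, F i y ∂μ := by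
    intro i
    rw [integral_const_mul, integral_finsetSum]
    · have : ∀ k : Fin n, ∫ x' : Fin n → X, F i (x' k) ∂μn = ∫ y, F i y ∂μ := fun k =>
        integral_comp_eval (hF i).aestronglyMeasurable
      simp only [this, Finset.sum_const, Finset.card_univ, Fintype.card_fin, nsmul_eq_mul]
      field_simp
    · intro k _
      exact integrable_of_abs_le ((hF i).comp (measurable_pi_apply k)) fun x => hM i _
  -- The mean is the average over an independent ghost sample.
  have hghost : ∫ x : Fin n → X, (⨆ i, |(1 / (n : ℝ)) * ∑ k, F i (x k) - ∫ y, F i y ∂μ|) ∂μn ≤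
      ∫ z, H 1 z ∂(μn.prod μn) := by
    rw [integral_prod _ (hHint 1)]
    refine integral_mono_of_nonneg (.of_forall fun x => Real.iSup_nonneg fun i => abs_nonneg _)
      (hHint 1).integral_prod_left (.of_forall fun x => ciSup_le fun i => ?_)
    have hx : (1 / (n : ℝ)) * ∑ k, F i (x k) - ∫ y, F i y ∂μ =
        ∫ x' : Fin n → X, (1 / (n : ℝ)) * ∑ k, (F i (x k) - F i (x' k)) ∂μn := by
      simp only [Finset.sum_sub_distrib, mul_sub]
      rw [integral_sub (integrable_const _), hmean]
      · simp
      · refine integrable_of_abs_le (M := M) (by have := hF i; fun_prop) fun x' => ?_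
        simpa using abs_signed_average_le hn 1 fun k => hM i (x' k)
    rw [hx]
    refine abs_integral_le_integral_abs.trans (integral_mono_of_nonneg
      (.of_forall fun x' => abs_nonneg _) ?_ (.of_forall fun x' => ?_))
    · exact integrable_of_abs_le ((hHmeas 1).comp measurable_prodMk_left) fun x' =>
        abs_ciSup_le_of_abs_le fun i => (abs_abs _).trans_le (hHterm 1 (x, x') i)
    · simpa [hH] using le_ciSup (bddAbove_range_of_abs_le fun i =>
        (abs_abs _).trans_le (hHterm 1 (x, x') i)) i
  -- Signs may be inserted by exchangeability; the triangle inequality then separates the samples.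
  have hsplit : ∀ ε, ∫ z, H 1 z ∂(μn.prod μn) ≤ 2 * ∫ x, S ε x ∂μn := by
    intro ε
    have h₁ : ∫ z, H 1 z ∂(μn.prod μn) = ∫ z, H ε z ∂(μn.prod μn) := by
      simp only [hH, Pi.one_apply, Units.val_one, Int.cast_one, one_mul]
      exact (integral_signed_difference_eq μ hF ε).symm
    rw [h₁]
    calc ∫ z, H ε z ∂(μn.prod μn) ≤ ∫ z, (S ε z.1 + S ε z.2) ∂(μn.prod μn) := by
          refine integral_mono (hHint ε) (((hSint ε).comp_fst μn).add ((hSint ε).comp_snd μn))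
            fun z => ciSup_le fun i => ?_
          have hb : ∀ x : Fin n → X, BddAbove (Set.range fun i => |(1 / (n : ℝ)) *
              ∑ k, ((ε k : ℤ) : ℝ) * F i (x k)|) := fun x =>
            bddAbove_range_of_abs_le fun i => (abs_abs _).trans_le (hSterm ε x i)
          simp only [mul_sub, Finset.sum_sub_distrib]
          exact (abs_sub _ _).trans (add_le_add (le_ciSup (hb z.1) i) (le_ciSup (hb z.2) i))
      _ = 2 * ∫ x, S ε x ∂μn := by
          rw [integral_add ((hSint ε).comp_fst μn) ((hSint ε).comp_snd μn), integral_fun_fst,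
            integral_fun_snd]
          simp [two_mul]
  refine hghost.trans ?_
  rw [integral_const_mul, integral_finsetSum _ fun ε _ => hSint ε]
  have hsum := Finset.sum_le_sum fun (ε : Fin n → ℤˣ) (_ : ε ∈ Finset.univ) => hsplit ε
  rw [Finset.sum_const, ← Finset.mul_sum, Finset.card_univ, nsmul_eq_mul] at hsum
  have hcard : ((Fintype.card (Fin n → ℤˣ) : ℕ) : ℝ) = 2 ^ n := by simp
  rw [hcard] at hsum
  have h2 : (0 : ℝ) < 2 ^ n := by positivity
  rw [mul_left_comm, one_div, le_inv_mul_iff₀ h2]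
  exact hsum

/-! ### Uniform deviations of empirical partial risks -/

/-- The uniform deviation of the empirical partial risk over the class `G`. -/
noncomputable def unifDev {X : Type*} [MeasurableSpace X] {n : ℕ} (ℓ : ℝ → ℤˣ → ℝ) (y : ℤˣ)
    (p : Measure X) (G : Set (X → ℝ)) (x : Fin n → X) : ℝ :=
  ⨆ g : G, |empRisk ℓ y x g.1 - partialRisk ℓ y p g.1|

lemma empRisk_mem_Icc {X : Type*} {n : ℕ} {ℓ : ℝ → ℤˣ → ℝ} {y : ℤˣ} {C : ℝ} (hn : 1 ≤ n)
    {g : X → ℝ} (hC : ∀ x, ℓ (g x) y ∈ Set.Icc 0 C) (x : Fin n → X) :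
    empRisk ℓ y x g ∈ Set.Icc 0 C := by
  refine ⟨mul_nonneg (by positivity) (Finset.sum_nonneg fun i _ => (hC _).1), ?_⟩
  refine (le_abs_self _).trans ?_
  simpa [empRisk] using abs_signed_average_le hn 1 fun i =>
    (abs_of_nonneg (hC (x i)).1).trans_le (hC (x i)).2

section UnifDev

variable {X : Type*} [MeasurableSpace X] {n : ℕ} {ℓ : ℝ → ℤˣ → ℝ} {y : ℤˣ} {p : Measure X}
  {G G₀ : Set (X → ℝ)} {C : ℝ}

lemma partialRisk_mem_Icc [IsProbabilityMeasure p] {g : X → ℝ}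
    (hC : ∀ x, ℓ (g x) y ∈ Set.Icc 0 C) : partialRisk ℓ y p g ∈ Set.Icc 0 C :=
  ⟨integral_nonneg fun x => (hC x).1, (le_abs_self _).trans
    (abs_integral_le_of_abs_le fun x => (abs_of_nonneg (hC x).1).trans_le (hC x).2)⟩

lemma abs_empRisk_sub_partialRisk_le [IsProbabilityMeasure p] (hn : 1 ≤ n) {g : X → ℝ}
    (hC : ∀ x, ℓ (g x) y ∈ Set.Icc 0 C) (x : Fin n → X) :
    |empRisk ℓ y x g - partialRisk ℓ y p g| ≤ C := by
  have h₁ := empRisk_mem_Icc hn hC x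
  have h₂ := partialRisk_mem_Icc (p := p) hC
  exact abs_le.2 ⟨by linarith [h₁.1, h₂.2], by linarith [h₁.2, h₂.1]⟩

lemma bddAbove_unifDev [IsProbabilityMeasure p] (hn : 1 ≤ n)
    (hC : ∀ g ∈ G, ∀ x, ℓ (g x) y ∈ Set.Icc 0 C) (x : Fin n → X) :
    BddAbove (Set.range fun g : G => |empRisk ℓ y x g.1 - partialRisk ℓ y p g.1|) :=
  bddAbove_range_of_abs_le fun g =>
    (abs_abs _).trans_le (abs_empRisk_sub_partialRisk_le hn (hC g.1 g.2) x)

lemma measurable_unifDev (hcount : G.Countable)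
    (hmeas : ∀ g ∈ G, Measurable fun x => ℓ (g x) y) :
    Measurable fun x : Fin n → X => unifDev ℓ y p G x := by
  have : Countable G := hcount.to_subtype
  refine Measurable.iSup fun g => ?_
  have := hmeas g.1 g.2
  unfold empRisk
  exact (((Finset.measurable_fun_sum _ fun i _ =>
    this.comp (measurable_pi_apply i)).const_mul _).sub_const _).abs

lemma abs_unifDev_le [IsProbabilityMeasure p] (hn : 1 ≤ n) (hne : G.Nonempty)
    (hC : ∀ g ∈ G, ∀ x, ℓ (g x) y ∈ Set.Icc 0 C) (x : Fin n → X) : |unifDev ℓ y p G x| ≤ C := by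
  have := hne.to_subtype
  exact abs_ciSup_le_of_abs_le fun g =>
    (abs_abs _).trans_le (abs_empRisk_sub_partialRisk_le hn (hC g.1 g.2) x)

lemma abs_unifDev_sub_update_le [IsProbabilityMeasure p] (hn : 1 ≤ n) (hne : G.Nonempty)
    (hC : ∀ g ∈ G, ∀ x, ℓ (g x) y ∈ Set.Icc 0 C) (i : Fin n) (x : Fin n → X) (z : X) :
    |unifDev ℓ y p G x - unifDev ℓ y p G (Function.update x i z)| ≤ C / n := by
  have := hne.to_subtype
  refine abs_ciSup_sub_ciSup_le (bddAbove_unifDev hn hC x) (bddAbove_unifDev hn hC _)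
    fun g => (abs_abs_sub_abs_le _ _).trans ?_
  rw [sub_sub_sub_cancel_right, empRisk, empRisk, ← mul_sub, ← Finset.sum_sub_distrib,
    Finset.sum_eq_single i]
  · rw [Function.update_self, abs_mul, abs_of_nonneg (by positivity), one_div, div_eq_inv_mul]
    refine mul_le_mul_of_nonneg_left ?_ (by positivity)
    have h₁ := hC g.1 g.2 (x i)
    have h₂ := hC g.1 g.2 z
    exact abs_le.2 ⟨by linarith [h₁.1, h₂.2], by linarith [h₁.2, h₂.1]⟩
  · intro j _ hj
    rw [Function.update_of_ne hj, sub_self]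
  · simp

/-- The uniform deviation over a countable pointwise dense subclass controls the whole class. -/
lemma abs_empRisk_sub_partialRisk_le_unifDev [IsProbabilityMeasure p] (hn : 1 ≤ n)
    (hmeas : ∀ g ∈ G₀, Measurable fun x => ℓ (g x) y)
    (hC : ∀ g ∈ G₀, ∀ x, ℓ (g x) y ∈ Set.Icc 0 C) {g : X → ℝ} {u : ℕ → X → ℝ}
    (hu : ∀ k, u k ∈ G₀) (hlim : ∀ x, Tendsto (fun k => ℓ (u k x) y) atTop (𝓝 (ℓ (g x) y)))
    (x : Fin n → X) :
    |empRisk ℓ y x g - partialRisk ℓ y p g| ≤ unifDev ℓ y p G₀ x := by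
  have h₁ : Tendsto (fun k => empRisk ℓ y x (u k)) atTop (𝓝 (empRisk ℓ y x g)) :=
    (tendsto_finsetSum _ fun i _ => hlim (x i)).const_mul _
  have h₂ : Tendsto (fun k => partialRisk ℓ y p (u k)) atTop (𝓝 (partialRisk ℓ y p g)) :=
    tendsto_integral_of_dominated_convergence (fun _ => C)
      (fun k => (hmeas _ (hu k)).aestronglyMeasurable) (integrable_const C)
      (fun k => .of_forall fun x => (abs_of_nonneg (hC _ (hu k) x).1).trans_le (hC _ (hu k) x).2)
      (.of_forall hlim)
  exact le_of_tendsto' (h₁.sub h₂).abs fun k => le_ciSup (bddAbove_unifDev hn hC x) ⟨u k, hu k⟩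

/-- The mean uniform deviation is at most `4 L` times the Rademacher complexity: a factor `2` for
symmetrization and a factor `2 L` for the contraction with absolute values. -/
lemma integral_unifDev_le [IsProbabilityMeasure p] (hn : 1 ≤ n) (hG₀ : G₀ ⊆ G)
    (hcount : G₀.Countable) (hne : G₀.Nonempty)
    (hsep : ∀ g ∈ G, ∃ u : ℕ → X → ℝ,
      (∀ k, u k ∈ G₀) ∧ ∀ x, Tendsto (fun k => u k x) atTop (𝓝 (g x)))
    (hmeas : ∀ g ∈ G, Measurable g) {Cg : ℝ} (hbdd : ∀ g ∈ G, ∀ x, |g x| ≤ Cg)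
    (hneg : ∀ g, g ∈ G ↔ -g ∈ G) {L : ℝ≥0} {ψ : ℝ → ℝ} (hψ : LipschitzWith L ψ)
    (hℓψ : ∀ g ∈ G, ∀ x, ℓ (g x) y = ψ (g x)) :
    ∫ x : Fin n → X, unifDev ℓ y p G₀ x ∂(Measure.pi fun _ => p) ≤ 4 * L * rademacher n p G := by
  have hn₀ : (n : ℝ) ≠ 0 := by exact_mod_cast (Nat.one_le_iff_ne_zero.1 hn)
  have : Countable G₀ := hcount.to_subtype
  have : Nonempty G₀ := hne.to_subtype
  have : Nonempty G := (hne.mono hG₀).to_subtype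
  have hψbdd : ∀ g ∈ G, ∀ x, |ψ (g x) - ψ 0| ≤ L * Cg := fun g hg x => by
    have := hψ.dist_le_mul (g x) 0
    rw [Real.dist_eq, Real.dist_eq, sub_zero] at this
    exact this.trans (mul_le_mul_of_nonneg_left (hbdd g hg x) L.coe_nonneg)
  have hψmeas : ∀ g ∈ G, Measurable fun x => ψ (g x) - ψ 0 := fun g hg =>
    (hψ.continuous.measurable.comp (hmeas g hg)).sub_const _
  have hsupBdd : ∀ (ε : Fin n → ℤˣ) (x : Fin n → X), ∀ g ∈ G,
      |(1 / (n : ℝ)) * ∑ k, ((ε k : ℤ) : ℝ) * g (x k)| ≤ Cg :=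
    fun ε x g hg => abs_signed_average_le hn ε fun k => hbdd g hg _
  have hsupEq : ∀ (ε : Fin n → ℤˣ) (x : Fin n → X),
      ⨆ g : G, (1 / (n : ℝ)) * ∑ k, ((ε k : ℤ) : ℝ) * g.1 (x k) =
        ⨆ g : G₀, (1 / (n : ℝ)) * ∑ k, ((ε k : ℤ) : ℝ) * g.1 (x k) := by
    intro ε x
    refine le_antisymm (ciSup_le fun g => ?_) (ciSup_le fun g => ?_)
    · obtain ⟨u, hu, hlim⟩ := hsep g.1 g.2
      exact le_of_tendsto' ((tendsto_finsetSum _ fun k _ =>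
        (hlim (x k)).const_mul ((ε k : ℤ) : ℝ)).const_mul _) fun j =>
          le_ciSup (bddAbove_range_of_abs_le fun g : G₀ => hsupBdd ε x g.1 (hG₀ g.2)) ⟨u j, hu j⟩
    · exact le_ciSup (bddAbove_range_of_abs_le fun g : G => hsupBdd ε x g.1 g.2) ⟨g.1, hG₀ g.2⟩
  have hradInt : Integrable (fun x : Fin n → X => (1 / (2 : ℝ) ^ n) *
      ∑ ε : Fin n → ℤˣ, ⨆ g : G, (1 / (n : ℝ)) * ∑ k, ((ε k : ℤ) : ℝ) * g.1 (x k))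
      (Measure.pi fun _ => p) := by
    refine (integrable_finsetSum _ fun ε _ => integrable_of_abs_le (M := Cg) ?_ fun x =>
      abs_ciSup_le_of_abs_le fun g => hsupBdd ε x g.1 g.2).const_mul _
    simp only [hsupEq ε]
    refine Measurable.iSup fun g => ?_
    have := hmeas g.1 (hG₀ g.2)
    fun_prop
  have hdev : ∀ x : Fin n → X, unifDev ℓ y p G₀ x = ⨆ g : G₀, |(1 / (n : ℝ)) *
      ∑ k, (ψ (g.1 (x k)) - ψ 0) - ∫ z, (ψ (g.1 z) - ψ 0) ∂p| := by
    intro x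
    refine iSup_congr fun g => ?_
    have hint : Integrable (fun z => ψ (g.1 z)) p :=
      ((integrable_of_abs_le (hψmeas g.1 (hG₀ g.2)) (hψbdd g.1 (hG₀ g.2))).add
        (integrable_const (ψ 0))).congr (.of_forall fun z => sub_add_cancel _ _)
    rw [integral_sub hint (integrable_const _), empRisk, partialRisk]
    simp only [hℓψ g.1 (hG₀ g.2), Finset.sum_sub_distrib, Finset.sum_const, Finset.card_univ,
      Fintype.card_fin, nsmul_eq_mul, integral_const, probReal_univ, smul_eq_mul]
    congr 1
    field_simp
    ring
  simp only [hdev]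
  refine (integral_ciSup_abs_average_sub_le hn p (F := fun (g : G₀) x => ψ (g.1 x) - ψ 0)
    (fun g => hψmeas g.1 (hG₀ g.2)) (M := L * Cg) fun g => hψbdd g.1 (hG₀ g.2)).trans ?_
  have hfour : 4 * L * rademacher n p G = 2 * ∫ x : Fin n → X, 2 * L * ((1 / (2 : ℝ) ^ n) *
      ∑ ε : Fin n → ℤˣ, ⨆ g : G, (1 / (n : ℝ)) * ∑ k, ((ε k : ℤ) : ℝ) * g.1 (x k))
      ∂(Measure.pi fun _ => p) := by
    rw [integral_const_mul, rademacher]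
    ring
  rw [hfour]
  refine mul_le_mul_of_nonneg_left (integral_mono_of_nonneg (.of_forall fun x => ?_)
    (hradInt.const_mul _) (.of_forall fun x => ?_)) zero_le_two
  · exact mul_nonneg (by positivity) (Finset.sum_nonneg fun ε _ =>
      Real.iSup_nonneg fun g => abs_nonneg _)
  · dsimp only
    rw [mul_left_comm]
    refine mul_le_mul_of_nonneg_left (le_trans (Finset.sum_le_sum fun ε _ => ?_)
      (sum_signs_ciSup_abs_comp_le (t := fun (g : G) k => g.1 (x k)) (C := Cg)
        (fun g k => hbdd g.1 g.2 _)
        (fun g => ⟨⟨-g.1, (hneg _).1 g.2⟩, rfl⟩) hψ)) (by positivity)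
    exact ciSup_le fun g => le_ciSup (bddAbove_range_of_abs_le fun g : G =>
      (abs_abs _).trans_le (abs_signed_average_le hn ε fun k => hψbdd g.1 g.2 (x k)))
        ⟨g.1, hG₀ g.2⟩

open ProbabilityTheory in
/-- A weighted sum of the uniform deviations for the two labels concentrates around its mean. -/
lemma hasSubgaussianMGF_unifDev [IsProbabilityMeasure p] (hn : 1 ≤ n) (hcount : G.Countable)
    (hne : G.Nonempty) (hmeas : ∀ y, ∀ g ∈ G, Measurable fun x => ℓ (g x) y)
    (hC : ∀ y, ∀ g ∈ G, ∀ x, ℓ (g x) y ∈ Set.Icc 0 C) {v w : ℝ} (hv : 0 ≤ v) (hw : 0 ≤ w) :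
    HasSubgaussianMGF (fun x : Fin n → X =>
        (v * unifDev ℓ 1 p G x + w * unifDev ℓ (-1) p G x) -
          ∫ x' : Fin n → X, (v * unifDev ℓ 1 p G x' + w * unifDev ℓ (-1) p G x')
            ∂(Measure.pi fun _ => p))
      (((v + w) * C) ^ 2 / (4 * n)).toNNReal (Measure.pi fun _ => p) := by
  have hn₀ : (n : ℝ) ≠ 0 := by exact_mod_cast (Nat.one_le_iff_ne_zero.1 hn)
  have hC₀ : 0 ≤ C := by
    obtain ⟨g, hg⟩ := hne
    obtain ⟨x⟩ := nonempty_of_isProbabilityMeasure p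
    exact (hC 1 g hg x).1.trans (hC 1 g hg x).2
  have hc₀ : 0 ≤ (v + w) * C / n := by positivity
  have h := hasSubgaussianMGF_of_bounded_differences (μ := p) (n := n)
    (f := fun x => v * unifDev ℓ 1 p G x + w * unifDev ℓ (-1) p G x)
    (((measurable_unifDev hcount (hmeas 1)).const_mul v).add
      ((measurable_unifDev hcount (hmeas (-1))).const_mul w)) (M := v * C + w * C)
    (fun x => by
      refine (abs_add_le _ _).trans ?_
      rw [abs_mul, abs_mul, abs_of_nonneg hv, abs_of_nonneg hw]
      exact add_le_add (mul_le_mul_of_nonneg_left (abs_unifDev_le hn hne (hC 1) x) hv)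
        (mul_le_mul_of_nonneg_left (abs_unifDev_le hn hne (hC (-1)) x) hw))
    (c := fun _ => ((v + w) * C / n).toNNReal)
    (fun i x z => by
      rw [add_sub_add_comm, ← mul_sub, ← mul_sub, Real.coe_toNNReal _ hc₀]
      refine (abs_add_le _ _).trans ?_
      rw [abs_mul, abs_mul, abs_of_nonneg hv, abs_of_nonneg hw, mul_div_assoc, add_mul]
      exact add_le_add
        (mul_le_mul_of_nonneg_left (abs_unifDev_sub_update_le hn hne (hC 1) i x z) hv)
        (mul_le_mul_of_nonneg_left (abs_unifDev_sub_update_le hn hne (hC (-1)) i x z) hw))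
  convert h using 1
  rw [← NNReal.coe_inj, Real.coe_toNNReal _ (by positivity)]
  simp only [Finset.sum_const, Finset.card_univ, Fintype.card_fin, nsmul_eq_mul, NNReal.coe_mul,
    NNReal.coe_natCast, NNReal.coe_pow, NNReal.coe_div, NNReal.coe_ofNat,
    Real.coe_toNNReal _ hc₀]
  field_simp
  norm_num

end UnifDev

/-! ### The risk and its corrected estimator -/

lemma isProbabilityMeasure_mixture {X : Type*} [MeasurableSpace X] (P N : Measure X)
    [IsProbabilityMeasure P] [IsProbabilityMeasure N] {θ : ℝ} (hθ : θ ∈ Set.Icc (0 : ℝ) 1) :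
    IsProbabilityMeasure (mixture θ P N) := by
  refine ⟨?_⟩
  rw [mixture, Measure.add_apply, Measure.smul_apply, Measure.smul_apply, measure_univ,
    measure_univ, smul_eq_mul, smul_eq_mul, mul_one, mul_one,
    ← ENNReal.ofReal_add hθ.1 (sub_nonneg.2 hθ.2)]
  simp

lemma integral_ofReal_smul_add {Ω : Type*} [MeasurableSpace Ω] {μ ν : Measure Ω} {s t : ℝ}
    (hs : 0 ≤ s) (ht : 0 ≤ t) {f : Ω → ℝ} (hμ : Integrable f μ) (hν : Integrable f ν) :
    ∫ z, f z ∂(ENNReal.ofReal s • μ + ENNReal.ofReal t • ν) =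
      s * ∫ z, f z ∂μ + t * ∫ z, f z ∂ν := by
  rw [integral_add_measure (hμ.smul_measure ENNReal.ofReal_ne_top)
    (hν.smul_measure ENNReal.ofReal_ne_top), integral_smul_measure, integral_smul_measure,
    ENNReal.toReal_ofReal hs, ENNReal.toReal_ofReal ht, smul_eq_mul, smul_eq_mul]

lemma partialRisk_mixture {X : Type*} [MeasurableSpace X] {P N : Measure X}
    [IsProbabilityMeasure P] [IsProbabilityMeasure N] {θ : ℝ} (hθ : θ ∈ Set.Icc (0 : ℝ) 1)
    {ℓ : ℝ → ℤˣ → ℝ} {y : ℤˣ} {g : X → ℝ} {C : ℝ} (hmeas : Measurable fun x => ℓ (g x) y)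
    (hC : ∀ x, |ℓ (g x) y| ≤ C) :
    partialRisk ℓ y (mixture θ P N) g =
      θ * partialRisk ℓ y P g + (1 - θ) * partialRisk ℓ y N g :=
  integral_ofReal_smul_add hθ.1 (sub_nonneg.2 hθ.2) (integrable_of_abs_le hmeas hC)
    (integrable_of_abs_le hmeas hC)

lemma risk_eq {X : Type*} [MeasurableSpace X] {P N : Measure X}
    [IsProbabilityMeasure P] [IsProbabilityMeasure N] {π : ℝ} (hπ : π ∈ Set.Ioo (0 : ℝ) 1)
    {ℓ : ℝ → ℤˣ → ℝ} {g : X → ℝ} {C : ℝ} (hmeas : ∀ y, Measurable fun x => ℓ (g x) y)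
    (hC : ∀ y x, |ℓ (g x) y| ≤ C) :
    risk ℓ π P N g = π * partialRisk ℓ 1 P g + (1 - π) * partialRisk ℓ (-1) N g := by
  have : MeasurableSingletonClass ℤˣ := ⟨fun u =>
    ⟨{(u : ℤ)}, measurableSet_singleton _, by ext v; simp [Units.ext_iff]⟩⟩
  have hm : Measurable fun z : X × ℤˣ => ℓ (g z.1) z.2 := measurable_from_prod_countable_left hmeas
  have hmk : ∀ y : ℤˣ, Measurable fun x : X => (x, y) := fun y => measurable_prodMk_right
  have : IsProbabilityMeasure (P.map fun x => (x, (1 : ℤˣ))) :=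
    Measure.isProbabilityMeasure_map (hmk _).aemeasurable
  have : IsProbabilityMeasure (N.map fun x => (x, (-1 : ℤˣ))) :=
    Measure.isProbabilityMeasure_map (hmk _).aemeasurable
  rw [risk, joint, integral_ofReal_smul_add hπ.1.le (sub_nonneg.2 hπ.2.le)
    (integrable_of_abs_le hm fun z => hC z.2 z.1) (integrable_of_abs_le hm fun z => hC z.2 z.1),
    integral_map (hmk _).aemeasurable hm.aestronglyMeasurable,
    integral_map (hmk _).aemeasurable hm.aestronglyMeasurable]
  rfl

/-- A consistent correction fixes the non-negative target `r`, so its error at an estimate `t` of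
`r` is at most the Lipschitz constant times the error of `t`: no bias term appears. -/
lemma IsConsistentCorrection.abs_apply_sub_le {f : ℝ → ℝ} (hf : IsConsistentCorrection f) {K : ℝ≥0}
    (hK : LipschitzWith K f) {r : ℝ} (hr : 0 ≤ r) (t : ℝ) : |f t - r| ≤ K * |t - r| := by
  have := hK.dist_le_mul t r
  rwa [hf.eq_self r hr, Real.dist_eq, Real.dist_eq] at this

/-- The corrected risk estimates the risk with an error controlled by the four deviations of the
empirical partial risks. -/
lemma abs_correctedRisk_sub_risk_le {X : Type*} [MeasurableSpace X] {P N : Measure X}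
    [IsProbabilityMeasure P] [IsProbabilityMeasure N] {π θ θ' : ℝ} (hπ : π ∈ Set.Ioo (0 : ℝ) 1)
    (hθ : θ ∈ Set.Icc (0 : ℝ) 1) (hθ' : θ' ∈ Set.Icc (0 : ℝ) 1) (hne : θ ≠ θ') {n n' : ℕ}
    {ℓ : ℝ → ℤˣ → ℝ} {g : X → ℝ} {C : ℝ} (hmeas : ∀ y, Measurable fun x => ℓ (g x) y)
    (hC : ∀ y x, ℓ (g x) y ∈ Set.Icc 0 C) {f₁ f₂ : ℝ → ℝ} (hf₁ : IsConsistentCorrection f₁)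
    (hf₂ : IsConsistentCorrection f₂) {K : ℝ≥0} (hK₁ : LipschitzWith K f₁)
    (hK₂ : LipschitzWith K f₂) (s : (Fin n → X) × (Fin n' → X)) :
    |correctedRisk f₁ f₂ ℓ π θ θ' s g - risk ℓ π P N g| ≤
      K * ((|coefA π θ θ'| * |empRisk ℓ 1 s.1 g - partialRisk ℓ 1 (mixture θ P N) g| +
          |coefB π θ θ'| * |empRisk ℓ (-1) s.1 g - partialRisk ℓ (-1) (mixture θ P N) g|) +
        (|coefC π θ θ'| * |empRisk ℓ 1 s.2 g - partialRisk ℓ 1 (mixture θ' P N) g| +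
          |coefD π θ θ'| * |empRisk ℓ (-1) s.2 g - partialRisk ℓ (-1) (mixture θ' P N) g|)) := by
  have hC' : ∀ y x, |ℓ (g x) y| ≤ C := fun y x => (abs_of_nonneg (hC y x).1).trans_le (hC y x).2
  have hsub : θ - θ' ≠ 0 := sub_ne_zero.2 hne
  -- The coefficients cancel the other class in the two mixtures.
  have hpos : π * partialRisk ℓ 1 P g =
      coefA π θ θ' * partialRisk ℓ 1 (mixture θ P N) g -
        coefC π θ θ' * partialRisk ℓ 1 (mixture θ' P N) g := by
    rw [partialRisk_mixture hθ (hmeas 1) (hC' 1), partialRisk_mixture hθ' (hmeas 1) (hC' 1),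
      coefA, coefC]
    field_simp
    ring
  have hneg : (1 - π) * partialRisk ℓ (-1) N g =
      coefD π θ θ' * partialRisk ℓ (-1) (mixture θ' P N) g -
        coefB π θ θ' * partialRisk ℓ (-1) (mixture θ P N) g := by
    rw [partialRisk_mixture hθ (hmeas (-1)) (hC' (-1)),
      partialRisk_mixture hθ' (hmeas (-1)) (hC' (-1)), coefD, coefB]
    field_simp
    ring
  have htri : ∀ u v r r' q q' : ℝ, |u * r - v * r' - (u * q - v * q')| ≤
      |u| * |r - q| + |v| * |r' - q'| := fun u v r r' q q' => by
    rw [sub_sub_sub_comm, ← mul_sub, ← mul_sub, ← abs_mul, ← abs_mul]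
    exact abs_sub _ _
  have h₁ := hf₁.abs_apply_sub_le hK₁
    (mul_nonneg hπ.1.le (partialRisk_mem_Icc (p := P) (hC 1)).1)
    (coefA π θ θ' * empRisk ℓ 1 s.1 g - coefC π θ θ' * empRisk ℓ 1 s.2 g)
  have h₂ := hf₂.abs_apply_sub_le hK₂
    (mul_nonneg (sub_nonneg.2 hπ.2.le) (partialRisk_mem_Icc (p := N) (hC (-1))).1)
    (coefD π θ θ' * empRisk ℓ (-1) s.2 g - coefB π θ θ' * empRisk ℓ (-1) s.1 g)
  rw [correctedRisk, risk_eq hπ hmeas hC', add_sub_add_comm]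
  refine (abs_add_le _ _).trans ((add_le_add h₁ h₂).trans ?_)
  rw [← mul_add]
  refine mul_le_mul_of_nonneg_left ?_ K.coe_nonneg
  rw [hpos, hneg]
  refine (add_le_add (htri _ _ _ _ _ _) (htri _ _ _ _ _ _)).trans_eq ?_
  ring

/-! ### The tail of two independent deviations -/

open ProbabilityTheory in
/-- Two independent sub-Gaussian deviations with variance proxies `K²/(4n)` and `K'²/(4n')` exceed
`√(log (1/δ) / 2) (K/√n + K'/√n')` with probability at most `δ`. -/
lemma measureReal_prod_le_of_hasSubgaussianMGF {Ω Ω' : Type*} [MeasurableSpace Ω]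
    [MeasurableSpace Ω'] {μ : Measure Ω} {ν : Measure Ω'} [IsProbabilityMeasure μ]
    [IsProbabilityMeasure ν] {U : Ω → ℝ} {V : Ω' → ℝ} (hUm : Measurable U) (hVm : Measurable V)
    {n n' : ℕ} (hn : 1 ≤ n) (hn' : 1 ≤ n') {K K' : ℝ} (hK : 0 ≤ K) (hK' : 0 ≤ K')
    (hpos : 0 < K + K') (hU : HasSubgaussianMGF U (K ^ 2 / (4 * n)).toNNReal μ)
    (hV : HasSubgaussianMGF V (K' ^ 2 / (4 * n')).toNNReal ν) {δ : ℝ} (hδ : 0 < δ)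
    (hδ₁ : δ ≤ 1) :
    (μ.prod ν).real {z | Real.sqrt (Real.log (1 / δ) / 2) * (K / Real.sqrt n + K' / Real.sqrt n') ≤
      U z.1 + V z.2} ≤ δ := by
  have hn₀ : (0 : ℝ) < n := by exact_mod_cast hn
  have hn₀' : (0 : ℝ) < n' := by exact_mod_cast hn'
  have hU' : HasSubgaussianMGF (fun z : Ω × Ω' => U z.1) (K ^ 2 / (4 * n)).toNNReal (μ.prod ν) :=
    HasSubgaussianMGF.of_map (Y := Prod.fst) measurable_fst.aemeasurable
      (by rwa [measurePreserving_fst.map_eq])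
  have hV' : HasSubgaussianMGF (fun z : Ω × Ω' => V z.2) (K' ^ 2 / (4 * n')).toNNReal
      (μ.prod ν) :=
    HasSubgaussianMGF.of_map (Y := Prod.snd) measurable_snd.aemeasurable
      (by rwa [measurePreserving_snd.map_eq])
  have hlog : 0 ≤ Real.log (1 / δ) := Real.log_nonneg ((one_le_div hδ).2 hδ₁)
  have hsum := hU'.add_of_indepFun hV' (indepFun_prod hUm hVm)
  refine (hsum.measure_ge_le (by positivity)).trans ?_
  rw [NNReal.coe_add, Real.coe_toNNReal _ (by positivity), Real.coe_toNNReal _ (by positivity),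
    mul_pow, Real.sq_sqrt (by positivity)]
  have hsq : K ^ 2 / n + K' ^ 2 / n' ≤ (K / Real.sqrt n + K' / Real.sqrt n') ^ 2 := by
    rw [add_sq, div_pow, div_pow, Real.sq_sqrt hn₀.le, Real.sq_sqrt hn₀'.le]
    have : 0 ≤ 2 * (K / Real.sqrt n) * (K' / Real.sqrt n') := by positivity
    linarith
  have hvar : 0 < K ^ 2 / n + K' ^ 2 / n' := by
    rcases hK.eq_or_lt with rfl | h
    · have : 0 < K' := by linarith
      positivity
    · positivity
  have hexp : Real.log (1 / δ) ≤ Real.log (1 / δ) / 2 * (K / Real.sqrt n + K' / Real.sqrt n') ^ 2 /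
      (2 * (K ^ 2 / (4 * n) + K' ^ 2 / (4 * n'))) := by
    have h4 : 2 * (K ^ 2 / (4 * n) + K' ^ 2 / (4 * n')) = (K ^ 2 / n + K' ^ 2 / n') / 2 := by
      field_simp
      ring
    rw [h4, le_div_iff₀ (by positivity)]
    have := mul_le_mul_of_nonneg_left hsq hlog
    linarith
  rw [neg_div]
  refine (Real.exp_le_exp.2 (neg_le_neg hexp)).trans_eq ?_
  rw [one_div, Real.log_inv, neg_neg, Real.exp_log hδ]

end UU

/-! ### The estimation error bound -/

/-- With probability at least `1 - δ` over the two samples, every minimizer `ĝ` of the corrected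
empirical risk over `G` obeys the estimation error bound. The absolute values cover both signs of
`θ - θ'`; for `θ' < θ` all four coefficients are non-negative. -/
theorem mainTheorem3 {X : Type*} [MeasurableSpace X]
    (P N : Measure X) [IsProbabilityMeasure P] [IsProbabilityMeasure N]
    (π θ θ' : ℝ) (hπ : π ∈ Set.Ioo (0 : ℝ) 1)
    (hθ : θ ∈ Set.Icc (0 : ℝ) 1) (hθ' : θ' ∈ Set.Icc (0 : ℝ) 1) (hne : θ ≠ θ')
    (n n' : ℕ) (hn : 1 ≤ n) (hn' : 1 ≤ n')
    (G : Set (X → ℝ)) (hGmeas : ∀ g ∈ G, Measurable g) (hGsep : UU.IsPointwiseSeparable G)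
    (Cg : ℝ) (hCg : 0 < Cg) (hGbdd : ∀ g ∈ G, ∀ x, |g x| ≤ Cg)
    (ℓ : ℝ → ℤˣ → ℝ) (hℓ : ∀ t y, 0 ≤ ℓ t y)
    (Cℓ : ℝ) (hCℓ : 0 < Cℓ) (hℓbdd : ∀ t y, |t| ≤ Cg → ℓ t y ≤ Cℓ)
    (Lℓ : ℝ≥0) (hℓlip : ∀ y, LipschitzOnWith Lℓ (fun t => ℓ t y) (Set.Icc (-Cg) Cg))
    (f₁ f₂ : ℝ → ℝ) (hf₁ : UU.IsConsistentCorrection f₁) (hf₂ : UU.IsConsistentCorrection f₂)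
    (Lf : ℝ≥0) (hLf₁ : LipschitzWith Lf f₁) (hLf₂ : LipschitzWith Lf f₂)
    (α β : ℝ) (hα : 0 < α / π) (hβ : 0 < β / (1 - π))
    (hRp : ∀ g ∈ G, α / π ≤ UU.partialRisk ℓ 1 P g)
    (hRn : ∀ g ∈ G, β / (1 - π) ≤ UU.partialRisk ℓ (-1) N g)
    (hGneg : ∀ g, g ∈ G ↔ -g ∈ G)
    (gstar : X → ℝ) (hgstar : gstar ∈ G) (hmin : IsMinOn (UU.risk ℓ π P N) G gstar)
    (δ : ℝ) (hδ : 0 < δ) :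
    ∃ E : Set ((Fin n → X) × (Fin n' → X)), MeasurableSet E ∧
      1 - δ ≤ (UU.sampleLaw n n' θ θ' P N).real E ∧
      ∀ s ∈ E, ∀ ghat ∈ G, IsMinOn (UU.correctedRisk f₁ f₂ ℓ π θ θ' s) G ghat →
        UU.risk ℓ π P N ghat - UU.risk ℓ π P N gstar ≤
          8 * (|UU.coefA π θ θ'| + |UU.coefB π θ θ'|) * Lf * Lℓ *
              UU.rademacher n (UU.mixture θ P N) G +
            8 * (|UU.coefC π θ θ'| + |UU.coefD π θ θ'|) * Lf * Lℓ *
              UU.rademacher n' (UU.mixture θ' P N) G +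
            2 * (Lf + 1) * (|UU.coefA π θ θ'| + |UU.coefB π θ θ'| + |UU.coefC π θ θ'| +
              |UU.coefD π θ θ'|) * Cℓ * UU.biasTail n n' π θ θ' Cℓ α β +
            2 * (Cℓ * Lf * Real.sqrt (Real.log (1 / δ) / 2)) *
              ((|UU.coefA π θ θ'| + |UU.coefB π θ θ'|) / Real.sqrt n +
                (|UU.coefC π θ θ'| + |UU.coefD π θ θ'|) / Real.sqrt n') := by
  rcases le_or_gt δ 1 with hδ₁ | hδ₁
  swap
  -- For `δ > 1` the claim is void.
  · exact ⟨∅, MeasurableSet.empty, by simpa using hδ₁.le, by simp⟩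
  obtain ⟨G₀, hG₀, hcount, hsep⟩ := hGsep
  have hne₀ : G₀.Nonempty := by
    obtain ⟨u, hu, -⟩ := hsep gstar hgstar
    exact ⟨u 0, hu 0⟩
  -- Only the values of the loss on `[-Cg, Cg]` matter, so it may be extended to a Lipschitz `ψ`.
  choose ψ hψ hψeq using fun y => (hℓlip y).extend_real
  have hℓψ : ∀ y, ∀ g ∈ G, ∀ x, ℓ (g x) y = ψ y (g x) := fun y g hg x =>
    hψeq y (abs_le.1 (hGbdd g hg x))
  have hlossMeas : ∀ y, ∀ g ∈ G, Measurable fun x => ℓ (g x) y := fun y g hg => by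
    simp only [hℓψ y g hg]
    exact (hψ y).continuous.measurable.comp (hGmeas g hg)
  have hlossIcc : ∀ y, ∀ g ∈ G, ∀ x, ℓ (g x) y ∈ Set.Icc 0 Cℓ := fun y g hg x =>
    ⟨hℓ _ _, hℓbdd _ _ (hGbdd g hg x)⟩
  have hmeas₀ : ∀ y, ∀ g ∈ G₀, Measurable fun x => ℓ (g x) y := fun y g hg =>
    hlossMeas y g (hG₀ hg)
  have hIcc₀ : ∀ y, ∀ g ∈ G₀, ∀ x, ℓ (g x) y ∈ Set.Icc 0 Cℓ := fun y g hg =>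
    hlossIcc y g (hG₀ hg)
  have hlim : ∀ g ∈ G, ∃ u : ℕ → X → ℝ, (∀ k, u k ∈ G₀) ∧
      ∀ y x, Tendsto (fun k => ℓ (u k x) y) atTop (𝓝 (ℓ (g x) y)) := fun g hg => by
    obtain ⟨u, hu, hux⟩ := hsep g hg
    refine ⟨u, hu, fun y x => ?_⟩
    simp only [hℓψ y g hg, fun k => hℓψ y (u k) (hG₀ (hu k)) x]
    exact ((hψ y).continuous.tendsto _).comp (hux x)
  have := UU.isProbabilityMeasure_mixture P N hθ
  have := UU.isProbabilityMeasure_mixture P N hθ'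
  set p := UU.mixture θ P N with hp
  set p' := UU.mixture θ' P N with hp'
  set a := UU.coefA π θ θ' with ha
  set b := UU.coefB π θ θ' with hb
  set c := UU.coefC π θ θ' with hc
  set d := UU.coefD π θ θ' with hd
  set U : (Fin n → X) → ℝ := fun x =>
    |a| * UU.unifDev ℓ 1 p G₀ x + |b| * UU.unifDev ℓ (-1) p G₀ x with hU
  set V : (Fin n' → X) → ℝ := fun x =>
    |c| * UU.unifDev ℓ 1 p' G₀ x + |d| * UU.unifDev ℓ (-1) p' G₀ x with hV
  have hUm : Measurable U := ((UU.measurable_unifDev hcount (hmeas₀ 1)).const_mul _).add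
    ((UU.measurable_unifDev hcount (hmeas₀ (-1))).const_mul _)
  have hVm : Measurable V := ((UU.measurable_unifDev hcount (hmeas₀ 1)).const_mul _).add
    ((UU.measurable_unifDev hcount (hmeas₀ (-1))).const_mul _)
  set EU : ℝ := ∫ x, U x ∂(Measure.pi fun _ => p) with hEU
  set EV : ℝ := ∫ x, V x ∂(Measure.pi fun _ => p') with hEV
  have hEUle : EU ≤ 4 * (|a| + |b|) * Lℓ * UU.rademacher n p G := by
    have hi : ∀ y, Integrable (fun x : Fin n → X => UU.unifDev ℓ y p G₀ x)
        (Measure.pi fun _ => p) := fun y =>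
      UU.integrable_of_abs_le (UU.measurable_unifDev hcount (hmeas₀ y))
        (UU.abs_unifDev_le hn hne₀ (hIcc₀ y))
    have hle := fun y => UU.integral_unifDev_le (p := p) hn hG₀ hcount hne₀ hsep hGmeas hGbdd hGneg
      (hψ y) (hℓψ y)
    rw [hEU, hU, integral_add ((hi 1).const_mul _) ((hi (-1)).const_mul _), integral_const_mul,
      integral_const_mul]
    refine (add_le_add (mul_le_mul_of_nonneg_left (hle 1) (abs_nonneg a))
      (mul_le_mul_of_nonneg_left (hle (-1)) (abs_nonneg b))).trans_eq ?_
    ring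
  have hEVle : EV ≤ 4 * (|c| + |d|) * Lℓ * UU.rademacher n' p' G := by
    have hi : ∀ y, Integrable (fun x : Fin n' → X => UU.unifDev ℓ y p' G₀ x)
        (Measure.pi fun _ => p') := fun y =>
      UU.integrable_of_abs_le (UU.measurable_unifDev hcount (hmeas₀ y))
        (UU.abs_unifDev_le hn' hne₀ (hIcc₀ y))
    have hle := fun y => UU.integral_unifDev_le (p := p') hn' hG₀ hcount hne₀ hsep hGmeas hGbdd
      hGneg (hψ y) (hℓψ y)
    rw [hEV, hV, integral_add ((hi 1).const_mul _) ((hi (-1)).const_mul _), integral_const_mul,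
      integral_const_mul]
    refine (add_le_add (mul_le_mul_of_nonneg_left (hle 1) (abs_nonneg c))
      (mul_le_mul_of_nonneg_left (hle (-1)) (abs_nonneg d))).trans_eq ?_
    ring
  set t : ℝ := Real.sqrt (Real.log (1 / δ) / 2) *
    ((|a| + |b|) * Cℓ / Real.sqrt n + (|c| + |d|) * Cℓ / Real.sqrt n') with ht
  -- The variance proxy is positive, because `a θ - c θ' = π` excludes `a = c = 0`.
  have hpos : 0 < (|a| + |b|) * Cℓ + (|c| + |d|) * Cℓ := by
    have hac : a * θ - c * θ' = π := by
      have : θ - θ' ≠ 0 := sub_ne_zero.2 hne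
      rw [ha, hc, UU.coefA, UU.coefC]
      field_simp
      ring
    have : 0 < |a| + |c| := by
      rcases eq_or_ne a 0 with h | h
      · rcases eq_or_ne c 0 with h' | h'
        · rw [h, h'] at hac
          linarith [hπ.1]
        · have := abs_pos.2 h'
          positivity
      · have := abs_pos.2 h
        positivity
    rw [← add_mul]
    have := abs_nonneg b
    have := abs_nonneg d
    exact mul_pos (by linarith) hCℓ
  have htail := UU.measureReal_prod_le_of_hasSubgaussianMGF (hUm.sub_const EU) (hVm.sub_const EV)
    hn hn' (by positivity) (by positivity) hpos
    (UU.hasSubgaussianMGF_unifDev hn hcount hne₀ hmeas₀ hIcc₀ (abs_nonneg a) (abs_nonneg b))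
    (UU.hasSubgaussianMGF_unifDev hn' hcount hne₀ hmeas₀ hIcc₀ (abs_nonneg c) (abs_nonneg d))
    hδ hδ₁
  have hmeasSum : Measurable fun s : (Fin n → X) × (Fin n' → X) =>
      U s.1 - EU + (V s.2 - EV) :=
    ((hUm.comp measurable_fst).sub_const _).add ((hVm.comp measurable_snd).sub_const _)
  refine ⟨{s | t ≤ U s.1 - EU + (V s.2 - EV)}ᶜ,
    (measurableSet_le measurable_const hmeasSum).compl, ?_, fun s hs ghat hghat hminhat => ?_⟩
  · rw [UU.sampleLaw, probReal_compl_eq_one_sub (measurableSet_le measurable_const hmeasSum)]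
    exact sub_le_sub_left htail 1
  · have hs' : U s.1 - EU + (V s.2 - EV) < t := not_le.1 hs
    have hdev : ∀ g ∈ G, |UU.correctedRisk f₁ f₂ ℓ π θ θ' s g - UU.risk ℓ π P N g| ≤
        Lf * (U s.1 + V s.2) := by
      intro g hg
      obtain ⟨u, hu, hux⟩ := hlim g hg
      refine (UU.abs_correctedRisk_sub_risk_le hπ hθ hθ' hne (fun y => hlossMeas y g hg)
        (fun y => hlossIcc y g hg) hf₁ hf₂ hLf₁ hLf₂ s).trans ?_
      have h₁ := fun y => UU.abs_empRisk_sub_partialRisk_le_unifDev (p := p) hn (hmeas₀ y)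
        (hIcc₀ y) hu (hux y) s.1
      have h₂ := fun y => UU.abs_empRisk_sub_partialRisk_le_unifDev (p := p') hn' (hmeas₀ y)
        (hIcc₀ y) hu (hux y) s.2
      exact mul_le_mul_of_nonneg_left (add_le_add
        (add_le_add (mul_le_mul_of_nonneg_left (h₁ 1) (abs_nonneg a))
          (mul_le_mul_of_nonneg_left (h₁ (-1)) (abs_nonneg b)))
        (add_le_add (mul_le_mul_of_nonneg_left (h₂ 1) (abs_nonneg c))
          (mul_le_mul_of_nonneg_left (h₂ (-1)) (abs_nonneg d)))) Lf.coe_nonneg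
    have h₁ := abs_le.1 (hdev ghat hghat)
    have h₂ := abs_le.1 (hdev gstar hgstar)
    have h₃ : UU.correctedRisk f₁ f₂ ℓ π θ θ' s ghat ≤ UU.correctedRisk f₁ f₂ ℓ π θ θ' s gstar :=
      hminhat hgstar
    have h₄ : (Lf : ℝ) * (U s.1 + V s.2) ≤ Lf * (4 * (|a| + |b|) * Lℓ * UU.rademacher n p G +
        4 * (|c| + |d|) * Lℓ * UU.rademacher n' p' G + t) :=
      mul_le_mul_of_nonneg_left (by linarith) Lf.coe_nonneg
    have h₅ : 0 ≤ 2 * ((Lf : ℝ) + 1) * (|a| + |b| + |c| + |d|) * Cℓ *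
        UU.biasTail n n' π θ θ' Cℓ α β := by
      have : 0 ≤ UU.biasTail n n' π θ θ' Cℓ α β :=
        add_nonneg (Real.exp_nonneg _) (Real.exp_nonneg _)
      positivity
    have h₆ : 2 * (Cℓ * Lf * Real.sqrt (Real.log (1 / δ) / 2)) *
        ((|a| + |b|) / Real.sqrt n + (|c| + |d|) / Real.sqrt n') = 2 * (Lf * t) := by
      rw [ht]
      ring
    rw [h₆]
    linarith [h₁.1, h₂.2]
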